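/- Let $\mathfrak g=\mathfrak{sl}_3(\mathbb C)$, let $\mathfrak h$ be its Cartan subalgebra of diagonal matrices, let $\varepsilon_i\in\mathfrak h^*$ be the $i$-th diagonal entry, $\alpha_1=\varepsilon_1-\varepsilon_2$, $\alpha_2=\varepsilon_2-\varepsilon_3$ the simple roots, and $\omega_1=\tfrac23\alpha_1+\tfrac13\alpha_2$, $\omega_2=\tfrac13\alpha_1+\tfrac23\alpha_2$ the fundamental dominant weights; write $(x,y)=x\omega_1+y\omega_2$. Consider the following table of 14 polyhedra in $\mathbb R^4$ (coordinates $x,y,a,b$), where an entry $L$ in the left column stands for the inequality $L\ge 0$ and all inequalities in a row are imposed together: $$\begin{array}{l|l} \text{Inequalities} & \text{Expression}\\ \hline x-y-a+b,\ x+2y-a+b,\ 2x+y-2a-b-3 & 0\\ -x+y+a-b,\ 2x+y+a-b,\ x+2y-a-2b-3 & 0\\ -2x-y-a+b,\ x+2y-a+b,\ -x+y-2a-b-3 & 0\\ -x+y+a-b,\ -x-2y+a-b,\ -2x-y-a-2b-3 & 0\\ x-y-a+b,\ -2x-y-a+b,\ -x-2y-2a-b-3 & 0\\ 2x+y+a-b,\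 -x-2y+a-b,\ x-y-a-2b-3 & 0\\ x-y-a+b,\ x+2y-a+b,\ -2x-y+2a+b+3,\ 2x+y+a-b & -\tfrac23x-\tfrac13y+\tfrac23a+\tfrac13b+1\\ -x+y+a-b,\ 2x+y+a-b,\ x+2y-a+b,\ -x-2y+a+2b+3 & -\tfrac13x-\tfrac23y+\tfrac13a+\tfrac23b+1\\ -2x-y-a+b,\ x+2y-a+b,\ x-y+2a+b+3,\ -x+y+a-b & \tfrac13x-\tfrac13y+\tfrac23a+\tfrac13b+1\\ -x+y+a-b,\ -2x-y-a+b,\ -x-2y+a-b,\ 2x+y+a+2b+3 & \tfrac23x+\tfrac13y+\tfrac13a+\tfrac23b+1\\ x-y-a+b,\ -2x-y-a+b,\ x+2y+2a+b+3,\ -x-2y+a-b & \tfrac13x+\tfrac23y+\tfrac23a+\tfrac13b+1\\ x-y-a+b,\ 2x+y+a-b,\ -x-2y+a-b,\ -x+y+a+2b+3 & -\tfrac13x+\tfrac13y+\tfrac13a+\tfrac23b+1\\ -x+y+a-b,\ 2x+y+a-b,\ -x-2y+a-b,\ a-b & b+1\\ x-y-a+b,\ x+2y-a+b,\ -2x-y-a+b,\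 -a+b & a+1 \end{array}$$ The 14 polyhedra cover $\mathbb R^4$, and there is a function $F(x,y,a,b)$, continuous on the region $\{a\ge 0,\ b\ge 0\}$, that equals the expression of each row at every point of that region lying in the polyhedron of that row. Moreover, let $a,b\ge 0$ be integers, let $\lambda=(a,b)$, and let $V(\lambda)$ be an irreducible finite-dimensional $\mathfrak g$-module with highest weight $\lambda$. Then for all integers $x,y$ (with $(x,y)$ not necessarily dominant) such that $\lambda-(x,y)$ lies in the root lattice $\mathbb Z\alpha_1+\mathbb Z\alpha_2$, the multiplicity of $(x,y)$ in $V(\lambda)$, i.e. the dimension $m_\lambda(x,y)$ of the weight space of weight $(x,y)$, is $F(x,y,a,b)$. -/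

import Mathlib

noncomputable section

namespace SlThree

/-- The complex Lie algebra `𝔰𝔩₃` of traceless `3 × 3` matrices. -/
abbrev 𝔤 : Type := LieAlgebra.SpecialLinear.sl (Fin 3) ℂ

/-- The Cartan subalgebra of diagonal traceless matrices. -/
def 𝔥 : LieSubalgebra ℂ 𝔤 where
  carrier := {H | H.val.IsDiag}
  zero_mem' := fun _ _ _ => rfl
  add_mem' := fun hA hB => Matrix.IsDiag.add hA hB
  smul_mem' := fun c _ hA => Matrix.IsDiag.smul c hA
  lie_mem' := by
    intro A B hA hB
    have hA' : A.val.IsDiag := hA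
    have hB' : B.val.IsDiag := hB
    change (A.val * B.val - B.val * A.val).IsDiag
    rw [← hA'.diagonal_diag, ← hB'.diagonal_diag, Matrix.diagonal_mul_diagonal,
      Matrix.diagonal_mul_diagonal]
    exact (Matrix.isDiag_diagonal _).sub (Matrix.isDiag_diagonal _)

/-- The linear form `ε i` on `𝔥` taking the `i`-th diagonal entry. -/
def ε (i : Fin 3) : Module.Dual ℂ 𝔥 where
  toFun H := H.val.val i i
  map_add' _ _ := rfl
  map_smul' _ _ := rfl

/-- The first simple root `α₁ = ε₁ - ε₂` (the code counts indices from zero). -/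
def α₁ : Module.Dual ℂ 𝔥 := ε 0 - ε 1

/-- The second simple root `α₂ = ε₂ - ε₃`. -/
def α₂ : Module.Dual ℂ 𝔥 := ε 1 - ε 2

/-- The first fundamental dominant weight, written in the basis of simple roots. -/
def ω₁ : Module.Dual ℂ 𝔥 := (2 / 3 : ℂ) • α₁ + (1 / 3 : ℂ) • α₂

/-- The second fundamental dominant weight, written in the basis of simple roots. -/
def ω₂ : Module.Dual ℂ 𝔥 := (1 / 3 : ℂ) • α₁ + (2 / 3 : ℂ) • α₂

/-- The integral weight `(x, y) = x ω₁ + y ω₂`. -/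
def wt (x y : ℤ) : Module.Dual ℂ 𝔥 := x • ω₁ + y • ω₂

/-- The root lattice `ℤ α₁ + ℤ α₂`. -/
def rootLattice : AddSubgroup (Module.Dual ℂ 𝔥) := AddSubgroup.closure {α₁, α₂}

section Modules

variable (V : Type*) [AddCommGroup V] [Module ℂ V] [LieRingModule 𝔤 V] [LieModule ℂ 𝔤 V]

/-- `V` has a nonzero weight vector of weight `lam` that is annihilated by all strictly upper
triangular matrices, i.e. by all the positive root spaces. If `V` is irreducible, this says that
`V` has highest weight `lam` with respect to the base `{α₁, α₂}`. -/
def HasHighestWeight (lam : Module.Dual ℂ 𝔥) : Prop :=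
  ∃ v : V, v ≠ 0 ∧ v ∈ LieModule.weightSpace V lam ∧
    ∀ X : 𝔤, (∀ i j : Fin 3, j ≤ i → X.val i j = 0) → ⁅X, v⁆ = 0

/-- The multiplicity of the weight `φ` in `V`: the dimension of the weight space. -/
def multiplicity (φ : Module.Dual ℂ 𝔥) : ℕ :=
  Module.finrank ℂ (LieModule.weightSpace V φ)

end Modules

/-- The system of inequalities in row `i` of the table. -/
def rowIneq (x y a b : ℝ) : Fin 14 → Prop := ![
  0 ≤ x - y - a + b ∧ 0 ≤ x + 2 * y - a + b ∧ 0 ≤ 2 * x + y - 2 * a - b - 3,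
  0 ≤ -x + y + a - b ∧ 0 ≤ 2 * x + y + a - b ∧ 0 ≤ x + 2 * y - a - 2 * b - 3,
  0 ≤ -2 * x - y - a + b ∧ 0 ≤ x + 2 * y - a + b ∧ 0 ≤ -x + y - 2 * a - b - 3,
  0 ≤ -x + y + a - b ∧ 0 ≤ -x - 2 * y + a - b ∧ 0 ≤ -2 * x - y - a - 2 * b - 3,
  0 ≤ x - y - a + b ∧ 0 ≤ -2 * x - y - a + b ∧ 0 ≤ -x - 2 * y - 2 * a - b - 3,
  0 ≤ 2 * x + y + a - b ∧ 0 ≤ -x - 2 * y + a - b ∧ 0 ≤ x - y - a - 2 * b - 3,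
  0 ≤ x - y - a + b ∧ 0 ≤ x + 2 * y - a + b ∧ 0 ≤ -2 * x - y + 2 * a + b + 3 ∧
    0 ≤ 2 * x + y + a - b,
  0 ≤ -x + y + a - b ∧ 0 ≤ 2 * x + y + a - b ∧ 0 ≤ x + 2 * y - a + b ∧
    0 ≤ -x - 2 * y + a + 2 * b + 3,
  0 ≤ -2 * x - y - a + b ∧ 0 ≤ x + 2 * y - a + b ∧ 0 ≤ x - y + 2 * a + b + 3 ∧
    0 ≤ -x + y + a - b,
  0 ≤ -x + y + a - b ∧ 0 ≤ -2 * x - y - a + b ∧ 0 ≤ -x - 2 * y + a - b ∧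
    0 ≤ 2 * x + y + a + 2 * b + 3,
  0 ≤ x - y - a + b ∧ 0 ≤ -2 * x - y - a + b ∧ 0 ≤ x + 2 * y + 2 * a + b + 3 ∧
    0 ≤ -x - 2 * y + a - b,
  0 ≤ x - y - a + b ∧ 0 ≤ 2 * x + y + a - b ∧ 0 ≤ -x - 2 * y + a - b ∧
    0 ≤ -x + y + a + 2 * b + 3,
  0 ≤ -x + y + a - b ∧ 0 ≤ 2 * x + y + a - b ∧ 0 ≤ -x - 2 * y + a - b ∧ 0 ≤ a - b,
  0 ≤ -a + b + x - y ∧ 0 ≤ -a + b + x + 2 * y ∧ 0 ≤ -a + b - 2 * x - y ∧ 0 ≤ -a + b]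

/-- The multiplicity expression in row `i` of the table. -/
def rowValue (x y a b : ℝ) : Fin 14 → ℝ := ![
  0, 0, 0, 0, 0, 0,
  -(2 / 3) * x - (1 / 3) * y + (2 / 3) * a + (1 / 3) * b + 1,
  -(1 / 3) * x - (2 / 3) * y + (1 / 3) * a + (2 / 3) * b + 1,
  (1 / 3) * x - (1 / 3) * y + (2 / 3) * a + (1 / 3) * b + 1,
  (2 / 3) * x + (1 / 3) * y + (1 / 3) * a + (2 / 3) * b + 1,
  (1 / 3) * x + (2 / 3) * y + (2 / 3) * a + (1 / 3) * b + 1,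
  -(1 / 3) * x + (1 / 3) * y + (1 / 3) * a + (2 / 3) * b + 1,
  b + 1,
  a + 1]

end SlThree

end

/-!
The inequalities in the table say where eight linear forms attain their minimum. Writing
`(a, b) - (x, y) = m α₁ + n α₂`, the function `F` is
`max 0 (1 + min (a, b, m, n, a + n - m, b + m - n, a + b - m, a + b - n))`, in the equivalent form
`max 0 (min (a, n, m, a + n - m) + 1 - max (0, n - b))`; on integral points it counts
Gelfand–Tsetlin patterns. That it restricts to the given expressions, and that the polyhedra cover
`ℝ⁴`, is a matter of the signs of a few linear forms (`multFun_eq_rowValue`, `exists_rowIneq`).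

For the multiplicities let `v` be a highest weight vector of an irreducible module, `Eᵢ, Fᵢ, Hᵢ` the
Chevalley generators and `F₃ = [F₂, F₁]`.

Upper bound. The monomials `F₂ ^ j F₃ ^ k F₁ ^ i v` span a submodule, hence the whole space, and
they vanish for `i > a`. Counting those of a given weight bounds the multiplicity by
`1 + min (a, m, n, a + n - m)` (or by `0`, if this is negative). The diagram automorphism gives the
same with the simple roots exchanged. The multiplicities do not increase under the simple
reflections, because in a finite-dimensional representation of `𝔰𝔩₂` the operator `f ^ k` is
injective on the weight space of weight `k ≥ 0` (`IsSl2Ops.eq_zero_of_pow_f_eq_zero`); this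
provides the remaining two forms (`ChevalleyOps.IsHighest.finrank_le`).

Lower bound. The operator `Z = F₃ H₁ + F₂ F₁` preserves the weight vectors killed by `E₁` and
commutes with `F₂`. For `i ≤ a` and `j ≤ b` the vector `Z ^ i F₂ ^ j v` is nonzero, since
`F₂ ^ (b - j)` maps it to `Z ^ i F₂ ^ b v`, a nonzero multiple of `F₃ ^ i F₂ ^ b v`, and `F₂ ^ b v`
is primitive of weight `a` for the `𝔰𝔩₂`-triple of the highest root. Among the vectors
`F₁ ^ l Z ^ i F₂ ^ j v`, those of a given weight are eigenvectors of the Casimir operator of the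
first `𝔰𝔩₂`-triple for distinct eigenvalues, so they are linearly independent
(`ChevalleyOps.IsHighest.le_finrank`).
-/

/-! ### Operators that shift weights, and `𝔰𝔩₂`-triples -/

namespace SlThree

open Module

section Sl2

variable {V : Type*} [AddCommGroup V] [Module ℂ V]

lemma pow_succ_apply_eq (f : End ℂ V) (n : ℕ) (x : V) : (f ^ (n + 1)) x = f ((f ^ n) x) := by
  rw [pow_succ', Module.End.mul_apply]

lemma shift_pow {h f : End ℂ V} {d : ℂ} (hf : ∀ x, h (f x) = f (h x) + d • f x) {c : ℂ} {x : V}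
    (hx : h x = c • x) (n : ℕ) : h ((f ^ n) x) = (c + n * d) • (f ^ n) x := by
  induction n with
  | zero => simp [hx]
  | succ n ih =>
    rw [pow_succ_apply_eq, hf, ih, map_smul, ← add_smul]
    congr 1
    push_cast
    ring

/-- In finite dimension, an operator that shifts the eigenvalues of another one by a nonzero
constant acts nilpotently on eigenvectors. -/
lemma exists_pow_eq_zero [FiniteDimensional ℂ V] {h f : End ℂ V} {d : ℂ} (hd : d ≠ 0)
    (hf : ∀ x, h (f x) = f (h x) + d • f x) {c : ℂ} {x : V} (hx : h x = c • x) :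
    ∃ n : ℕ, (f ^ n) x = 0 := by
  by_contra! hne
  have hinj : Function.Injective fun n : ℕ => c + n * d := fun m n hmn => by
    have := mul_right_cancel₀ hd (add_left_cancel hmn)
    exact_mod_cast this
  refine Set.infinite_range_of_injective hinj ((End.finite_hasEigenvalue h).subset ?_)
  rintro _ ⟨n, rfl⟩
  exact End.hasEigenvalue_of_hasEigenvector
    (End.hasEigenvector_iff.2 ⟨End.mem_eigenspace_iff.2 (shift_pow hf hx n), hne n⟩)

/-- Three operators satisfying the relations of an `𝔰𝔩₂`-triple; all of them may be zero, unlike in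
`IsSl2Triple`. -/
structure IsSl2Ops (e f h : End ℂ V) : Prop where
  ef : ∀ x, e (f x) = f (e x) + h x
  he : ∀ x, h (e x) = e (h x) + (2 : ℂ) • e x
  hf : ∀ x, h (f x) = f (h x) + (-2 : ℂ) • f x

namespace IsSl2Ops

variable {e f h : End ℂ V}

lemma symm (T : IsSl2Ops e f h) : IsSl2Ops f e (-h) where
  ef x := by simp [T.ef]
  he x := by simp [T.hf, add_comm]
  hf x := by simp [T.he, add_comm]

lemma e_pow_f (T : IsSl2Ops e f h) {c : ℂ} {x : V} (hx : h x = c • x) (n : ℕ) :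
    e ((f ^ (n + 1)) x) = (f ^ (n + 1)) (e x) + ((n + 1) * (c - n)) • (f ^ n) x := by
  induction n with
  | zero => simp [T.ef, hx]
  | succ n ih =>
    rw [pow_succ_apply_eq, T.ef, ih, shift_pow T.hf hx, map_add, map_smul, ← pow_succ_apply_eq,
      ← pow_succ_apply_eq, add_assoc, ← add_smul]
    congr 2
    push_cast
    ring

lemma e_pow_f_of_primitive (T : IsSl2Ops e f h) {c : ℂ} {x : V} (hx : h x = c • x) (he : e x = 0)
    (n : ℕ) : e ((f ^ (n + 1)) x) = ((n + 1) * (c - n)) • (f ^ n) x := by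
  simp [T.e_pow_f hx, he]

lemma pow_f_ne_zero (T : IsSl2Ops e f h) {c : ℕ} {x : V} (hx : h x = (c : ℂ) • x) (he : e x = 0)
    (hx0 : x ≠ 0) {n : ℕ} (hn : n ≤ c) : (f ^ n) x ≠ 0 := by
  induction n with
  | zero => simpa
  | succ n ih =>
    intro h0
    have := T.e_pow_f_of_primitive hx he n
    rw [h0, map_zero, eq_comm, smul_eq_zero] at this
    refine this.elim (fun h1 => ?_) (ih (by omega))
    rcases mul_eq_zero.1 h1 with h2 | h2
    · exact Nat.cast_add_one_ne_zero n h2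
    · have : c = n := by exact_mod_cast sub_eq_zero.1 h2
      omega

lemma pow_f_eq_zero [FiniteDimensional ℂ V] (T : IsSl2Ops e f h) {c : ℕ} {x : V}
    (hx : h x = (c : ℂ) • x) (he : e x = 0) : (f ^ (c + 1)) x = 0 := by
  classical
  by_cases hx0 : x = 0
  · simp [hx0]
  have hex := exists_pow_eq_zero (by norm_num) T.hf hx
  obtain ⟨n, hn⟩ : ∃ n, Nat.find hex = n + 1 :=
    Nat.exists_eq_succ_of_ne_zero fun h0 => hx0 (by simpa [h0] using Nat.find_spec hex)
  have h1 : (f ^ (n + 1)) x = 0 := hn ▸ Nat.find_spec hex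
  have h2 : (f ^ n) x ≠ 0 := Nat.find_min hex (by omega)
  have h3 := T.e_pow_f_of_primitive hx he n
  rw [h1, map_zero, eq_comm, smul_eq_zero] at h3
  rcases mul_eq_zero.1 (h3.resolve_right h2) with h4 | h4
  · exact absurd h4 (Nat.cast_add_one_ne_zero n)
  · have : c = n := by exact_mod_cast sub_eq_zero.1 h4
    rwa [this]

/-- On the weight space of weight `k ≥ 0`, the operator `f ^ k` is injective. The induction on a
power of `e` that kills `x` applies to `e x`, of weight `k + 2`, and leaves the case of a primitive
vector. -/
lemma eq_zero_of_pow_f_eq_zero [FiniteDimensional ℂ V] (T : IsSl2Ops e f h) {k : ℕ} {x : V}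
    (hx : h x = (k : ℂ) • x) (hf : (f ^ k) x = 0) : x = 0 := by
  obtain ⟨N, hN⟩ := exists_pow_eq_zero (by norm_num) T.he hx
  induction N generalizing k x with
  | zero => simpa using hN
  | succ N ih =>
    have h0 : ∀ j, (f ^ (k + j)) x = 0 := fun j => by
      rw [add_comm, pow_add, Module.End.mul_apply, hf, map_zero]
    have hex : e x = 0 := by
      refine ih (k := k + 2) ?_ ?_ ?_
      · rw [T.he, hx, map_smul, ← add_smul]
        push_cast
        rfl
      · have := T.e_pow_f hx (k + 1)
        rw [h0 2, h0 1] at this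
        simpa using this.symm
      · rwa [pow_succ, Module.End.mul_apply] at hN
    by_contra hx0
    exact T.pow_f_ne_zero hx hex hx0 le_rfl hf

/-- The Casimir operator of an `𝔰𝔩₂`-triple, multiplied by `4`. -/
def casimir (e f h : End ℂ V) : End ℂ V := (4 : ℂ) • (f * e) + h * h + (2 : ℂ) • h

lemma casimir_f (T : IsSl2Ops e f h) (x : V) :
    casimir e f h (f x) = f (casimir e f h x) := by
  simp only [casimir, LinearMap.add_apply, LinearMap.smul_apply, Module.End.mul_apply, T.ef, T.hf,
    map_add, map_smul]
  module

lemma casimir_pow_f (T : IsSl2Ops e f h) {c : ℂ} {x : V} (hx : h x = c • x) (he : e x = 0)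
    (n : ℕ) : casimir e f h ((f ^ n) x) = (c * (c + 2)) • (f ^ n) x := by
  induction n with
  | zero =>
    simp only [casimir, pow_zero, Module.End.one_apply, LinearMap.add_apply, LinearMap.smul_apply,
      Module.End.mul_apply, he, hx, map_zero, map_smul]
    module
  | succ n ih => rw [pow_succ_apply_eq, T.casimir_f, ih, map_smul]

end IsSl2Ops

end Sl2

/-- If eigenvectors of `T` span the whole space, then each eigenspace is spanned by those of them
that it contains. -/
lemma eigenspace_le_span {V ι : Type*} [AddCommGroup V] [Module ℂ V] (T : End ℂ V) (w : ι → V)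
    (c : ι → ℂ) (hw : ∀ t, T (w t) = c t • w t) (hspan : Submodule.span ℂ (Set.range w) = ⊤)
    (μ : ℂ) : T.eigenspace μ ≤ Submodule.span ℂ (w '' {t | c t = μ}) := by
  intro u hu
  have hle : ∀ s : Set ι, (⊤ : Submodule ℂ V) ≤
      Submodule.span ℂ (w '' s) ⊔ Submodule.span ℂ (w '' sᶜ) := fun s => by
    rw [← Submodule.span_union, ← Set.image_union, Set.union_compl_self, Set.image_univ, hspan]
  obtain ⟨p, hp, q, hq, rfl⟩ := Submodule.mem_sup.1 (hle {t | c t = μ} (Submodule.mem_top (x := u)))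
  have hpT : p ∈ T.eigenspace μ := by
    refine Submodule.span_le.2 ?_ hp
    rintro _ ⟨t, ht, rfl⟩
    exact End.mem_eigenspace_iff.2 (by rw [hw, show c t = μ from ht])
  have hqT : q ∈ ⨆ ν, ⨆ _ : ν ≠ μ, T.eigenspace ν := by
    refine Submodule.span_le.2 ?_ hq
    rintro _ ⟨t, ht, rfl⟩
    exact Submodule.mem_iSup_of_mem (c t) (Submodule.mem_iSup_of_mem ht
      (End.mem_eigenspace_iff.2 (hw t)))
  have hq0 : q = 0 := Submodule.disjoint_def.1 (T.eigenspaces_iSupIndep μ) q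
    (by simpa using Submodule.sub_mem _ hu hpT) hqT
  simpa [hq0] using hp

end SlThree

/-! ### Chevalley operators of `𝔰𝔩₃` and highest weight vectors -/

namespace SlThree

open Module

/-- Operators on `V` satisfying the relations between the Chevalley generators of `𝔰𝔩₃` and the
lowering operator `F₃ = [F₂, F₁]`. -/
structure ChevalleyOps (V : Type*) [AddCommGroup V] [Module ℂ V] where
  E₁ : End ℂ V
  E₂ : End ℂ V
  F₁ : End ℂ V
  F₂ : End ℂ V
  F₃ : End ℂ V
  H₁ : End ℂ V
  H₂ : End ℂ V
  E₁F₁ : ∀ x, E₁ (F₁ x) = F₁ (E₁ x) + H₁ x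
  E₁F₂ : ∀ x, E₁ (F₂ x) = F₂ (E₁ x)
  E₁F₃ : ∀ x, E₁ (F₃ x) = F₃ (E₁ x) - F₂ x
  E₂F₁ : ∀ x, E₂ (F₁ x) = F₁ (E₂ x)
  E₂F₂ : ∀ x, E₂ (F₂ x) = F₂ (E₂ x) + H₂ x
  E₂F₃ : ∀ x, E₂ (F₃ x) = F₃ (E₂ x) + F₁ x
  F₂F₁ : ∀ x, F₂ (F₁ x) = F₁ (F₂ x) + F₃ x
  F₁F₃ : ∀ x, F₁ (F₃ x) = F₃ (F₁ x)
  F₂F₃ : ∀ x, F₂ (F₃ x) = F₃ (F₂ x)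
  H₁E₁ : ∀ x, H₁ (E₁ x) = E₁ (H₁ x) + (2 : ℂ) • E₁ x
  H₁E₂ : ∀ x, H₁ (E₂ x) = E₂ (H₁ x) + (-1 : ℂ) • E₂ x
  H₂E₁ : ∀ x, H₂ (E₁ x) = E₁ (H₂ x) + (-1 : ℂ) • E₁ x
  H₂E₂ : ∀ x, H₂ (E₂ x) = E₂ (H₂ x) + (2 : ℂ) • E₂ x
  H₁F₁ : ∀ x, H₁ (F₁ x) = F₁ (H₁ x) + (-2 : ℂ) • F₁ x
  H₁F₂ : ∀ x, H₁ (F₂ x) = F₂ (H₁ x) + (1 : ℂ) • F₂ x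
  H₁F₃ : ∀ x, H₁ (F₃ x) = F₃ (H₁ x) + (-1 : ℂ) • F₃ x
  H₂F₁ : ∀ x, H₂ (F₁ x) = F₁ (H₂ x) + (1 : ℂ) • F₁ x
  H₂F₂ : ∀ x, H₂ (F₂ x) = F₂ (H₂ x) + (-2 : ℂ) • F₂ x
  H₂F₃ : ∀ x, H₂ (F₃ x) = F₃ (H₂ x) + (-1 : ℂ) • F₃ x

namespace ChevalleyOps

variable {V : Type*} [AddCommGroup V] [Module ℂ V] (T : ChevalleyOps V)

/-- The diagram automorphism of `𝔰𝔩₃`, exchanging the two simple roots. -/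
def swap : ChevalleyOps V where
  E₁ := T.E₂
  E₂ := T.E₁
  F₁ := T.F₂
  F₂ := T.F₁
  F₃ := -T.F₃
  H₁ := T.H₂
  H₂ := T.H₁
  E₁F₁ := T.E₂F₂
  E₁F₂ := T.E₂F₁
  E₁F₃ x := by simp [T.E₂F₃]; abel
  E₂F₁ := T.E₁F₂
  E₂F₂ := T.E₁F₁
  E₂F₃ x := by simp [T.E₁F₃]; abel
  F₂F₁ x := by simp [T.F₂F₁]
  F₁F₃ x := by simp [T.F₂F₃]
  F₂F₃ x := by simp [T.F₁F₃]
  H₁E₁ := T.H₂E₂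
  H₁E₂ := T.H₂E₁
  H₂E₁ := T.H₁E₂
  H₂E₂ := T.H₁E₁
  H₁F₁ := T.H₂F₂
  H₁F₂ := T.H₂F₁
  H₁F₃ x := by simp [T.H₂F₃]; abel
  H₂F₁ := T.H₁F₂
  H₂F₂ := T.H₁F₁
  H₂F₃ x := by simp [T.H₁F₃]; abel

lemma isSl2Ops₁ : IsSl2Ops T.E₁ T.F₁ T.H₁ := ⟨T.E₁F₁, T.H₁E₁, T.H₁F₁⟩

lemma isSl2Ops₂ : IsSl2Ops T.E₂ T.F₂ T.H₂ := T.swap.isSl2Ops₁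

/-- The raising operator of the highest root. -/
def E₃ : End ℂ V := T.E₁ * T.E₂ - T.E₂ * T.E₁

lemma isSl2Ops₃ : IsSl2Ops T.E₃ T.F₃ (T.H₁ + T.H₂) where
  ef x := by
    simp only [E₃, LinearMap.sub_apply, LinearMap.add_apply, Module.End.mul_apply, T.E₁F₃, T.E₂F₃,
      T.E₁F₁, T.E₂F₂, map_add, map_sub]
    abel
  he x := by
    simp only [E₃, LinearMap.sub_apply, LinearMap.add_apply, Module.End.mul_apply, T.H₁E₁, T.H₁E₂,
      T.H₂E₁, T.H₂E₂, map_add, map_sub, map_smul]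
    module
  hf x := by
    simp only [LinearMap.add_apply, T.H₁F₃, T.H₂F₃, map_add]
    module

/-- The space of vectors of weight `x ω₁ + y ω₂`. -/
def weightSpace (x y : ℤ) : Submodule ℂ V :=
  T.H₁.eigenspace (x : ℂ) ⊓ T.H₂.eigenspace (y : ℂ)

variable {T} in
lemma mem_weightSpace {x y : ℤ} {u : V} :
    u ∈ T.weightSpace x y ↔ T.H₁ u = (x : ℂ) • u ∧ T.H₂ u = (y : ℂ) • u := by
  simp only [weightSpace, Submodule.mem_inf, End.mem_eigenspace_iff]

lemma weightSpace_swap (x y : ℤ) : T.swap.weightSpace y x = T.weightSpace x y :=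
  inf_comm _ _

/-- Multiplicities do not increase under the simple reflection `s₁`. -/
lemma finrank_weightSpace_le_reflect₁ [FiniteDimensional ℂ V] (x y : ℤ) :
    finrank ℂ (T.weightSpace x y) ≤ finrank ℂ (T.weightSpace (-x) (x + y)) := by
  obtain ⟨g, hg0, hg⟩ : ∃ g : End ℂ V, (∀ u, T.H₁ u = (x : ℂ) • u → g u = 0 → u = 0) ∧
      ∀ u ∈ T.weightSpace x y, g u ∈ T.weightSpace (-x) (x + y) := by
    rcases le_total 0 x with h | h
    · lift x to ℕ using h
      refine ⟨T.F₁ ^ x, fun u hu h0 => T.isSl2Ops₁.eq_zero_of_pow_f_eq_zero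
        (by simpa using hu) h0, fun u hu => ?_⟩
      rw [mem_weightSpace] at hu ⊢
      rw [shift_pow T.H₁F₁ hu.1, shift_pow T.H₂F₁ hu.2]
      constructor <;> congr 1 <;> push_cast <;> ring
    · obtain ⟨k, rfl⟩ : ∃ k : ℕ, x = -k := ⟨x.natAbs, by omega⟩
      refine ⟨T.E₁ ^ k, fun u hu h0 => T.isSl2Ops₁.symm.eq_zero_of_pow_f_eq_zero
        (by simp [hu]) h0, fun u hu => ?_⟩
      rw [mem_weightSpace] at hu ⊢
      rw [shift_pow T.H₁E₁ hu.1, shift_pow T.H₂E₁ hu.2]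
      constructor <;> congr 1 <;> push_cast <;> ring
  refine LinearMap.finrank_le_finrank_of_injective (f := g.restrict hg) ?_
  rw [← LinearMap.ker_eq_bot, LinearMap.ker_eq_bot']
  rintro ⟨u, hu⟩ h0
  exact Subtype.ext (hg0 u (mem_weightSpace.1 hu).1 (congrArg Subtype.val h0))

/-- Multiplicities do not increase under the simple reflection `s₂`. -/
lemma finrank_weightSpace_le_reflect₂ [FiniteDimensional ℂ V] (x y : ℤ) :
    finrank ℂ (T.weightSpace x y) ≤ finrank ℂ (T.weightSpace (x + y) (-y)) := by
  rw [← weightSpace_swap, ← T.weightSpace_swap (x + y), add_comm x y]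
  exact T.swap.finrank_weightSpace_le_reflect₁ y x

/-- `v` is a highest weight vector of weight `a ω₁ + b ω₂`, and it generates `V`. -/
structure IsHighest (v : V) (a b : ℕ) : Prop where
  ne_zero : v ≠ 0
  E₁ : T.E₁ v = 0
  E₂ : T.E₂ v = 0
  H₁ : T.H₁ v = (a : ℂ) • v
  H₂ : T.H₂ v = (b : ℂ) • v
  eq_top : ∀ S : Submodule ℂ V, v ∈ S → (∀ u ∈ S, T.E₁ u ∈ S) → (∀ u ∈ S, T.E₂ u ∈ S) →
    (∀ u ∈ S, T.F₁ u ∈ S) → (∀ u ∈ S, T.F₂ u ∈ S) → S = ⊤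

/-- The monomial `F₂ ^ j F₃ ^ k F₁ ^ i` applied to `v`. -/
def monomial (v : V) (i k j : ℕ) : V := (T.F₂ ^ j) ((T.F₃ ^ k) ((T.F₁ ^ i) v))

lemma pow_comm_apply {f g : End ℂ V} (h : ∀ x, f (g x) = g (f x)) (n : ℕ) (x : V) :
    f ((g ^ n) x) = (g ^ n) (f x) := by
  induction n with
  | zero => simp
  | succ n ih => rw [pow_succ_apply_eq, h, ih, ← pow_succ_apply_eq]

lemma F₁_F₂_pow (j : ℕ) (x : V) :
    T.F₁ ((T.F₂ ^ (j + 1)) x) =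
      (T.F₂ ^ (j + 1)) (T.F₁ x) - ((j : ℂ) + 1) • (T.F₂ ^ j) (T.F₃ x) := by
  have h : ∀ x, T.F₁ (T.F₂ x) = T.F₂ (T.F₁ x) - T.F₃ x := fun x => by rw [T.F₂F₁]; abel
  induction j with
  | zero => simp [h]
  | succ j ih =>
    rw [pow_succ_apply_eq, h, ih, pow_comm_apply (fun x => (T.F₂F₃ x).symm),
      pow_succ_apply_eq T.F₂ (j + 1), pow_succ_apply_eq T.F₂ j (T.F₃ x), map_sub, map_smul]
    push_cast
    module

lemma E₁_F₃_pow (k : ℕ) (x : V) :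
    T.E₁ ((T.F₃ ^ (k + 1)) x) =
      (T.F₃ ^ (k + 1)) (T.E₁ x) - ((k : ℂ) + 1) • T.F₂ ((T.F₃ ^ k) x) := by
  induction k with
  | zero => simp [T.E₁F₃]
  | succ k ih =>
    rw [pow_succ_apply_eq, T.E₁F₃, ih, pow_succ_apply_eq T.F₃ (k + 1),
      pow_succ_apply_eq T.F₃ k x, map_sub, map_smul, T.F₂F₃]
    push_cast
    module

lemma E₂_F₃_pow (k : ℕ) (x : V) :
    T.E₂ ((T.F₃ ^ (k + 1)) x) =
      (T.F₃ ^ (k + 1)) (T.E₂ x) + ((k : ℂ) + 1) • (T.F₃ ^ k) (T.F₁ x) := by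
  induction k with
  | zero => simp [T.E₂F₃]
  | succ k ih =>
    rw [pow_succ_apply_eq, T.E₂F₃, ih, pow_comm_apply T.F₁F₃,
      pow_succ_apply_eq T.F₃ (k + 1), pow_succ_apply_eq T.F₃ k (T.F₁ x), map_add, map_smul]
    push_cast
    module

variable {T}

namespace IsHighest

variable {v : V} {a b : ℕ} (hv : T.IsHighest v a b)

include hv

lemma swap : T.swap.IsHighest v b a where
  ne_zero := hv.ne_zero
  E₁ := hv.E₂
  E₂ := hv.E₁
  H₁ := hv.H₂
  H₂ := hv.H₁
  eq_top S h h₁ h₂ h₃ h₄ := hv.eq_top S h h₂ h₁ h₄ h₃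

lemma H₁_monomial (i k j : ℕ) :
    T.H₁ (T.monomial v i k j) = ((a : ℂ) - 2 * i - k + j) • T.monomial v i k j := by
  rw [monomial, shift_pow T.H₁F₂ (shift_pow T.H₁F₃ (shift_pow T.H₁F₁ hv.H₁ i) k) j]
  congr 1
  ring

lemma H₂_monomial (i k j : ℕ) :
    T.H₂ (T.monomial v i k j) = ((b : ℂ) + i - k - 2 * j) • T.monomial v i k j := by
  rw [monomial, shift_pow T.H₂F₂ (shift_pow T.H₂F₃ (shift_pow T.H₂F₁ hv.H₂ i) k) j]
  congr 1
  ring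

/-- The monomials span `V`: commuting a generator to the right through a monomial gives a
combination of monomials, so their span is a submodule. -/
lemma span_monomial :
    Submodule.span ℂ (Set.range fun t : ℕ × ℕ × ℕ => T.monomial v t.1 t.2.1 t.2.2) = ⊤ := by
  set S := Submodule.span ℂ (Set.range fun t : ℕ × ℕ × ℕ => T.monomial v t.1 t.2.1 t.2.2)
  have hS : ∀ i k j, (T.F₂ ^ j) ((T.F₃ ^ k) ((T.F₁ ^ i) v)) ∈ S := fun i k j =>
    Submodule.subset_span ⟨(i, k, j), rfl⟩
  have key : ∀ g : End ℂ V, (∀ i k j, g ((T.F₂ ^ j) ((T.F₃ ^ k) ((T.F₁ ^ i) v))) ∈ S) →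
      ∀ u ∈ S, g u ∈ S := fun g hg u hu => by
    refine (Submodule.span_le (p := S.comap g)).2 ?_ hu
    rintro _ ⟨⟨i, k, j⟩, rfl⟩
    exact hg i k j
  refine hv.eq_top S (hS 0 0 0) (key _ fun i k j => ?_) (key _ fun i k j => ?_)
    (key _ fun i k j => ?_) (key _ fun i k j => ?_)
  · rw [pow_comm_apply T.E₁F₂]
    have h1 : (T.F₂ ^ j) ((T.F₃ ^ k) (T.E₁ ((T.F₁ ^ i) v))) ∈ S := by
      cases i with
      | zero => simp [hv.E₁]
      | succ i =>
        rw [T.isSl2Ops₁.e_pow_f_of_primitive hv.H₁ hv.E₁, map_smul, map_smul]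
        exact S.smul_mem _ (hS _ _ _)
    cases k with
    | zero => simpa using h1
    | succ k =>
      rw [T.E₁_F₃_pow, map_sub, map_smul, ← pow_comm_apply (fun _ => rfl), ← pow_succ_apply_eq]
      exact S.sub_mem h1 (S.smul_mem _ (hS _ _ _))
  · have h1 : (T.F₂ ^ j) (T.E₂ ((T.F₃ ^ k) ((T.F₁ ^ i) v))) ∈ S := by
      have h0 : T.E₂ ((T.F₁ ^ i) v) = 0 := by rw [pow_comm_apply T.E₂F₁, hv.E₂, map_zero]
      cases k with
      | zero => simp [h0]
      | succ k =>
        rw [T.E₂_F₃_pow, h0, map_zero, zero_add, map_smul, ← pow_succ_apply_eq]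
        exact S.smul_mem _ (hS _ _ _)
    cases j with
    | zero => simpa using h1
    | succ j =>
      rw [T.isSl2Ops₂.e_pow_f (by simpa [monomial] using hv.H₂_monomial i k 0)]
      exact S.add_mem h1 (S.smul_mem _ (hS _ _ _))
  · have h1 : (T.F₂ ^ j) (T.F₁ ((T.F₃ ^ k) ((T.F₁ ^ i) v))) ∈ S := by
      rw [pow_comm_apply T.F₁F₃, ← pow_succ_apply_eq]
      exact hS _ _ _
    cases j with
    | zero => simpa using h1
    | succ j =>
      rw [T.F₁_F₂_pow, ← pow_succ_apply_eq T.F₃]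
      exact S.sub_mem h1 (S.smul_mem _ (hS _ _ _))
  · rw [← pow_succ_apply_eq]
    exact hS _ _ _

/-! ### Upper bounds for the multiplicities -/

variable [FiniteDimensional ℂ V]

omit [FiniteDimensional ℂ V] in
lemma weightSpace_le_span_monomial (x y : ℤ) :
    T.weightSpace x y ≤ Submodule.span ℂ
      ((fun t : ℕ × ℕ × ℕ => T.monomial v t.1 t.2.1 t.2.2) ''
        {t | (a : ℤ) - 2 * t.1 - t.2.1 + t.2.2 = x ∧ (b : ℤ) + t.1 - t.2.1 - 2 * t.2.2 = y}) := by
  intro u hu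
  -- On integral weights the single operator `H₁ + i H₂` separates weights.
  have hu' : u ∈ (T.H₁ + Complex.I • T.H₂).eigenspace ((x : ℂ) + Complex.I * (y : ℂ)) := by
    rw [mem_weightSpace] at hu
    rw [End.mem_eigenspace_iff, LinearMap.add_apply, LinearMap.smul_apply, hu.1, hu.2]
    module
  refine Submodule.span_mono (Set.image_mono fun t ht => ?_)
    (eigenspace_le_span (T.H₁ + Complex.I • T.H₂)
      (fun t : ℕ × ℕ × ℕ => T.monomial v t.1 t.2.1 t.2.2)
      (fun t => (((a : ℤ) - 2 * t.1 - t.2.1 + t.2.2 : ℤ) : ℂ) +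
        Complex.I * (((b : ℤ) + t.1 - t.2.1 - 2 * t.2.2 : ℤ) : ℂ)) (fun t => by
          rw [LinearMap.add_apply, LinearMap.smul_apply, hv.H₁_monomial, hv.H₂_monomial]
          push_cast
          module) hv.span_monomial _ hu')
  have h1 := congrArg Complex.re ht
  have h2 := congrArg Complex.im ht
  simp only [Complex.add_re, Complex.add_im, Complex.mul_re, Complex.mul_im, Complex.I_re,
    Complex.I_im, Complex.intCast_re, Complex.intCast_im, zero_mul, one_mul, mul_zero, sub_zero,
    add_zero, zero_add] at h1 h2
  exact ⟨Int.cast_injective h1, Int.cast_injective h2⟩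

lemma monomial_eq_zero {i : ℕ} (hi : a < i) (k j : ℕ) : T.monomial v i k j = 0 := by
  obtain ⟨d, rfl⟩ := Nat.exists_eq_add_of_lt hi
  rw [monomial, show a + d + 1 = d + (a + 1) by ring, pow_add, Module.End.mul_apply,
    T.isSl2Ops₁.pow_f_eq_zero hv.H₁ hv.E₁, map_zero, map_zero, map_zero]

/-- The weight space of `λ - m α₁ - n α₂` is spanned by the monomials of that weight with
`i ≤ a`, one for each `k` in an interval. -/
lemma finrank_le_of_monomial (m n : ℤ) :
    (finrank ℂ (T.weightSpace (a - 2 * m + n) (b + m - 2 * n)) : ℤ) ≤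
      max 0 (min m n + 1 - max 0 (m - a)) := by
  classical
  -- The weight forces `i + k = m` and `j + k = n`, and `i ≤ a` amounts to `m - a ≤ k`.
  set K := Finset.Icc (max 0 (m - a)) (min m n) with hK
  set g : ℤ → V := fun k => T.monomial v (m - k).toNat k.toNat (n - k).toNat with hg
  have hle : T.weightSpace (a - 2 * m + n) (b + m - 2 * n) ≤
      Submodule.span ℂ (K.image g : Set V) := by
    refine (hv.weightSpace_le_span_monomial _ _).trans (Submodule.span_le.2 ?_)
    rintro _ ⟨⟨i, k, j⟩, ⟨h1, h2⟩, rfl⟩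
    simp only at h1 h2
    rw [SetLike.mem_coe]
    rcases le_or_gt i a with hi | hi
    · have e1 : m - k = i := by omega
      have e2 : n - k = j := by omega
      refine Submodule.subset_span (Finset.mem_coe.2 (Finset.mem_image.2 ⟨k, ?_, ?_⟩))
      · rw [hK, Finset.mem_Icc]
        omega
      · simp only [hg, e1, e2, Int.toNat_natCast]
    · simp only [hv.monomial_eq_zero hi, Submodule.zero_mem]
  have h1 := (Submodule.finrank_mono hle).trans (finrank_span_finset_le_card _)
  have h2 := h1.trans Finset.card_image_le
  rw [hK, Int.card_Icc] at h2
  omega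

lemma finrank_le_of_monomial_swap (m n : ℤ) :
    (finrank ℂ (T.weightSpace (a - 2 * m + n) (b + m - 2 * n)) : ℤ) ≤
      max 0 (min m n + 1 - max 0 (n - b)) := by
  have := hv.swap.finrank_le_of_monomial n m
  rw [weightSpace_swap] at this
  rw [min_comm]
  convert this using 4 <;> ring_nf

/-- Combines the bounds from the two orderings of the monomials with those that follow from them
by the simple reflections. -/
lemma finrank_le (m n : ℤ) :
    (finrank ℂ (T.weightSpace (a - 2 * m + n) (b + m - 2 * n)) : ℤ) ≤
      max 0 (min (min (a : ℤ) n) (min m (a + n - m)) + 1 - max 0 (n - b)) := by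
  have h1 := hv.finrank_le_of_monomial m n
  have h2 := hv.finrank_le_of_monomial_swap m n
  have h3 := T.finrank_weightSpace_le_reflect₁ (a - 2 * m + n) (b + m - 2 * n)
  have h4 := hv.finrank_le_of_monomial_swap (a + n - m) n
  have h5 := T.finrank_weightSpace_le_reflect₂ (a - 2 * m + n) (b + m - 2 * n)
  have h6 := hv.finrank_le_of_monomial m (b + m - n)
  rw [show (a : ℤ) - 2 * (a + n - m) + n = -(a - 2 * m + n) by ring,
    show (b : ℤ) + (a + n - m) - 2 * n = a - 2 * m + n + (b + m - 2 * n) by ring] at h4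
  rw [show (a : ℤ) - 2 * m + (b + m - n) = a - 2 * m + n + (b + m - 2 * n) by ring,
    show (b : ℤ) + m - 2 * (b + m - n) = -(b + m - 2 * n) by ring] at h6
  omega

end IsHighest

end ChevalleyOps

end SlThree

/-! ### Lower bounds for the multiplicities -/

namespace SlThree

open Module

namespace ChevalleyOps

variable {V : Type*} [AddCommGroup V] [Module ℂ V] (T : ChevalleyOps V)

/-- The Gelfand–Tsetlin lowering operator `F₃ H₁ + F₂ F₁`, which commutes with `F₂` and preserves
the weight vectors killed by `E₁`. -/
def gtLower : End ℂ V := T.F₃ * T.H₁ + T.F₂ * T.F₁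

lemma gtLower_apply (x : V) : T.gtLower x = T.F₃ (T.H₁ x) + T.F₂ (T.F₁ x) := rfl

lemma F₂_gtLower (x : V) : T.F₂ (T.gtLower x) = T.gtLower (T.F₂ x) := by
  have h : T.F₁ (T.F₂ x) = T.F₂ (T.F₁ x) - T.F₃ x := by rw [T.F₂F₁]; abel
  simp only [gtLower_apply, map_add, h, T.H₁F₂, map_sub, map_smul, T.F₂F₃]
  module

lemma H₁_gtLower (x : V) :
    T.H₁ (T.gtLower x) = T.gtLower (T.H₁ x) + (-1 : ℂ) • T.gtLower x := by
  simp only [gtLower_apply, map_add, map_smul, T.H₁F₂, T.H₁F₁, T.H₁F₃]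
  module

lemma H₂_gtLower {x : V} {c d : ℂ} (hx : T.H₁ x = c • x) (hy : T.H₂ x = d • x) :
    T.H₂ (T.gtLower x) = (d - 1) • T.gtLower x := by
  simp only [gtLower_apply, map_add, map_smul, T.H₂F₂, T.H₂F₁, T.H₂F₃, hx, hy]
  module

lemma E₁_gtLower {x : V} {c : ℂ} (hx : T.H₁ x = c • x) (he : T.E₁ x = 0) :
    T.E₁ (T.gtLower x) = 0 := by
  simp only [gtLower_apply, map_add, map_smul, T.E₁F₂, T.E₁F₁, T.E₁F₃, hx, he, map_zero]
  module

lemma gtLower_of_F₂_eq_zero {x : V} {c : ℂ} (hx : T.H₁ x = c • x) (hf : T.F₂ x = 0) :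
    T.gtLower x = (c + 1) • T.F₃ x := by
  rw [gtLower_apply, T.F₂F₁, hx, hf, map_smul, map_zero]
  module

lemma gtLower_pow_of_F₂_eq_zero {x : V} {d : ℕ} (hx : T.H₁ x = (d : ℂ) • x) (hf : T.F₂ x = 0)
    {i : ℕ} (hi : i ≤ d) : ∃ c : ℂ, c ≠ 0 ∧ (T.gtLower ^ i) x = c • (T.F₃ ^ i) x := by
  induction i with
  | zero => exact ⟨1, one_ne_zero, by simp⟩
  | succ i ih =>
    obtain ⟨c, hc, h⟩ := ih (by omega)
    refine ⟨c * (((d + i * (-1) : ℂ)) + 1), mul_ne_zero hc ?_, ?_⟩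
    · obtain ⟨r, rfl⟩ := Nat.exists_eq_add_of_lt hi
      have : ((r + 2 : ℕ) : ℂ) ≠ 0 := Nat.cast_ne_zero.2 (by omega)
      convert this using 1
      push_cast
      ring
    · rw [pow_succ_apply_eq, h, map_smul, T.gtLower_of_F₂_eq_zero (shift_pow T.H₁F₃ hx i)
        (by rw [pow_comm_apply T.F₂F₃, hf, map_zero]), smul_smul, pow_succ_apply_eq]

/-- The Gelfand–Tsetlin vector `F₁ ^ l (F₃ H₁ + F₂ F₁) ^ i F₂ ^ j v`. -/
def gtVector (v : V) (l i j : ℕ) : V := (T.F₁ ^ l) ((T.gtLower ^ i) ((T.F₂ ^ j) v))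

variable {T}

namespace IsHighest

variable {v : V} {a b : ℕ} (hv : T.IsHighest v a b)

include hv

lemma H₁_gtVector (l i j : ℕ) :
    T.H₁ (T.gtVector v l i j) = ((a : ℂ) + j - i - 2 * l) • T.gtVector v l i j := by
  rw [gtVector, shift_pow T.H₁F₁ (shift_pow T.H₁_gtLower (shift_pow T.H₁F₂ hv.H₁ j) i) l]
  congr 1
  ring

lemma H₂_gtVector_zero (i j : ℕ) :
    T.H₂ (T.gtVector v 0 i j) = ((b : ℂ) - 2 * j - i) • T.gtVector v 0 i j := by
  induction i with
  | zero =>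
    simp only [gtVector, pow_zero, Module.End.one_apply]
    rw [shift_pow T.H₂F₂ hv.H₂ j]
    congr 1
    push_cast
    ring
  | succ i ih =>
    have h : T.gtVector v 0 (i + 1) j = T.gtLower (T.gtVector v 0 i j) := by
      simp only [gtVector, pow_zero, Module.End.one_apply, pow_succ_apply_eq]
    rw [h, T.H₂_gtLower (hv.H₁_gtVector 0 i j) ih]
    congr 1
    push_cast
    ring

lemma H₂_gtVector (l i j : ℕ) :
    T.H₂ (T.gtVector v l i j) = ((b : ℂ) - 2 * j - i + l) • T.gtVector v l i j := by
  have := shift_pow T.H₂F₁ (hv.H₂_gtVector_zero i j) l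
  simpa [gtVector] using this

lemma E₁_gtVector_zero (i j : ℕ) : T.E₁ (T.gtVector v 0 i j) = 0 := by
  induction i with
  | zero => simp [gtVector, pow_comm_apply T.E₁F₂, hv.E₁]
  | succ i ih =>
    have h : T.gtVector v 0 (i + 1) j = T.gtLower (T.gtVector v 0 i j) := by
      simp only [gtVector, pow_zero, Module.End.one_apply, pow_succ_apply_eq]
    rw [h, T.E₁_gtLower (hv.H₁_gtVector 0 i j) ih]

/-- The extremal vector `F₂ ^ b v` is primitive for the `𝔰𝔩₂`-triple of the highest root, so `F₃`
can be applied to it `a` times. -/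
lemma F₃_pow_F₂_pow_ne_zero {i : ℕ} (hi : i ≤ a) : (T.F₃ ^ i) ((T.F₂ ^ b) v) ≠ 0 := by
  refine T.isSl2Ops₃.pow_f_ne_zero (c := a) ?_ ?_
    (T.isSl2Ops₂.pow_f_ne_zero hv.H₂ hv.E₂ hv.ne_zero le_rfl) hi
  · rw [LinearMap.add_apply, shift_pow T.H₁F₂ hv.H₁, shift_pow T.H₂F₂ hv.H₂]
    module
  · have h : ∀ n, T.E₁ ((T.F₂ ^ n) v) = 0 := fun n => by
      rw [pow_comm_apply T.E₁F₂, hv.E₁, map_zero]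
    rw [E₃, LinearMap.sub_apply, Module.End.mul_apply, Module.End.mul_apply, h, map_zero, sub_zero]
    cases b with
    | zero => simp [hv.E₂]
    | succ b => rw [T.isSl2Ops₂.e_pow_f_of_primitive hv.H₂ hv.E₂, map_smul, h, smul_zero]

variable [FiniteDimensional ℂ V]

/-- As `F₂` commutes with the lowering operator, applying it `b - j` more times reduces to the
case `j = b`, where the lowering operator acts as a multiple of `F₃`. -/
lemma gtVector_zero_ne_zero {i j : ℕ} (hi : i ≤ a) (hj : j ≤ b) : T.gtVector v 0 i j ≠ 0 := by
  intro h0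
  have h1 : (T.F₂ ^ (b - j)) (T.gtVector v 0 i j) = (T.gtLower ^ i) ((T.F₂ ^ b) v) := by
    rw [gtVector, pow_zero, Module.End.one_apply,
      pow_comm_apply (f := T.F₂ ^ (b - j)) (g := T.gtLower)
        (fun x => (pow_comm_apply (fun y => (T.F₂_gtLower y).symm) _ x).symm),
      ← Module.End.mul_apply (T.F₂ ^ (b - j)), ← pow_add, Nat.sub_add_cancel hj]
  have hH : T.H₁ ((T.F₂ ^ b) v) = ((a + b : ℕ) : ℂ) • (T.F₂ ^ b) v := by
    rw [shift_pow T.H₁F₂ hv.H₁]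
    push_cast
    rw [mul_one]
  have hF : T.F₂ ((T.F₂ ^ b) v) = 0 := by
    rw [← pow_succ_apply_eq, T.isSl2Ops₂.pow_f_eq_zero hv.H₂ hv.E₂]
  obtain ⟨c, hc, h2⟩ := T.gtLower_pow_of_F₂_eq_zero hH hF (i := i) (by omega)
  rw [h0, map_zero, h2, eq_comm, smul_eq_zero] at h1
  exact h1.elim hc (hv.F₃_pow_F₂_pow_ne_zero hi)

lemma gtVector_ne_zero {l i j : ℕ} (hi : i ≤ a) (hj : j ≤ b) (hl : l + i ≤ a + j) :
    T.gtVector v l i j ≠ 0 := by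
  obtain ⟨c, hc⟩ := Nat.exists_eq_add_of_le hl
  have hH : T.H₁ (T.gtVector v 0 i j) = ((l + c : ℕ) : ℂ) • T.gtVector v 0 i j := by
    rw [hv.H₁_gtVector]
    congr 1
    have : (a : ℂ) + j = l + i + c := by exact_mod_cast hc
    rw [this]
    push_cast
    ring
  have := T.isSl2Ops₁.pow_f_ne_zero hH (hv.E₁_gtVector_zero i j)
    (hv.gtVector_zero_ne_zero hi hj) (n := l) (by omega)
  simpa [gtVector] using this

/-- The Gelfand–Tsetlin vectors of a given weight are eigenvectors of the Casimir operator of the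
first `𝔰𝔩₂`-triple for distinct eigenvalues. -/
lemma le_finrank (m n : ℤ) :
    max 0 (min (min (a : ℤ) n) (min m (a + n - m)) + 1 - max 0 (n - b)) ≤
      (finrank ℂ (T.weightSpace (a - 2 * m + n) (b + m - 2 * n)) : ℤ) := by
  -- The weight forces `l + i = m` and `i + j = n`; the vector is nonzero if `i ≤ a`, `j ≤ b` and
  -- `l` is at most the eigenvalue `a + j - i` of `H₁` on `gtVector v 0 i j`.
  set K := Finset.Icc (max 0 (n - b)) (min (min (a : ℤ) n) (min m (a + n - m))) with hK
  have hmem : ∀ i : K, 0 ≤ (i : ℤ) ∧ n - b ≤ i ∧ (i : ℤ) ≤ a ∧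
      (i : ℤ) ≤ n ∧ (i : ℤ) ≤ m ∧ (i : ℤ) ≤ a + n - m := by
    rintro ⟨i, hi⟩
    rw [hK, Finset.mem_Icc] at hi
    dsimp only
    omega
  let g : K → V := fun i => T.gtVector v (m - i).toNat (i : ℤ).toNat (n - i).toNat
  have hg : ∀ i : K, ∃ l i' j : ℕ, (i : ℤ) = i' ∧ m = l + i ∧ n = i + j ∧
      g i = T.gtVector v l i' j := fun i => by
    have := hmem i
    exact ⟨(m - i).toNat, (i : ℤ).toNat, (n - i).toNat, by omega, by omega, by omega, rfl⟩
  -- The Casimir eigenvalue `c (c + 2)` for `c = a + n - 2 i ≥ 0`, which is injective in `i`.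
  let μ : K → ℂ := fun i => ((a + n - 2 * i : ℤ) : ℂ) * ((a + n - 2 * i : ℤ) + 2)
  have hμ : Function.Injective μ := by
    intro i i' h
    have h1 := hmem i
    have h2 := hmem i'
    have h3 : (a + n - 2 * (i : ℤ)) * (a + n - 2 * i + 2) =
        (a + n - 2 * (i' : ℤ)) * (a + n - 2 * i' + 2) := by
      simp only [μ] at h
      exact_mod_cast h
    have h4 : ((i' : ℤ) - i) * (4 * (a + n - i - i' + 1)) = 0 := by linear_combination h3
    rcases mul_eq_zero.1 h4 with h5 | h5
    · exact Subtype.ext (by omega)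
    · omega
  have hind : LinearIndependent ℂ g := by
    refine End.eigenvectors_linearIndependent' (IsSl2Ops.casimir T.E₁ T.F₁ T.H₁) μ hμ g fun i => ?_
    have h1 := hmem i
    obtain ⟨l, i', j, h2, h3, h4, h5⟩ := hg i
    refine End.hasEigenvector_iff.2 ⟨End.mem_eigenspace_iff.2 ?_, ?_⟩
    · have := T.isSl2Ops₁.casimir_pow_f (hv.H₁_gtVector 0 i' j) (hv.E₁_gtVector_zero i' j) l
      have h6 : g i = (T.F₁ ^ l) (T.gtVector v 0 i' j) := by simp [h5, gtVector]
      rw [h6, this]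
      congr 1
      simp only [μ, h2, h4]
      push_cast
      ring
    · rw [h5]
      exact hv.gtVector_ne_zero (by omega) (by omega) (by omega)
  have hW : ∀ i : K, g i ∈ T.weightSpace (a - 2 * m + n) (b + m - 2 * n) := fun i => by
    obtain ⟨l, i', j, h2, h3, h4, h5⟩ := hg i
    rw [mem_weightSpace, h5, hv.H₁_gtVector, hv.H₂_gtVector, h3, h4, h2]
    constructor <;> congr 1 <;> push_cast <;> ring
  have hcard : Fintype.card K ≤ finrank ℂ (T.weightSpace (a - 2 * m + n) (b + m - 2 * n)) := by
    refine LinearIndependent.fintype_card_le_finrank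
      (b := fun i => (⟨g i, hW i⟩ : T.weightSpace (a - 2 * m + n) (b + m - 2 * n))) ?_
    exact LinearIndependent.of_comp (Submodule.subtype _) hind
  rw [Fintype.card_coe, hK, Int.card_Icc] at hcard
  omega

theorem finrank_weightSpace (m n : ℤ) :
    (finrank ℂ (T.weightSpace (a - 2 * m + n) (b + m - 2 * n)) : ℤ) =
      max 0 (min (min (a : ℤ) n) (min m (a + n - m)) + 1 - max 0 (n - b)) :=
  le_antisymm (hv.finrank_le m n) (hv.le_finrank m n)

end IsHighest

end ChevalleyOps

end SlThree

/-! ### The action of the Lie algebra of traceless matrices -/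

namespace SlThree

open Module LieAlgebra.SpecialLinear

lemma val_lie (X Y : 𝔤) : ⁅X, Y⁆.val = X.val * Y.val - Y.val * X.val := rfl

lemma single_lie_single_swap {i j : Fin 3} (h : i ≠ j) :
    ⁅(single i j h 1 : 𝔤), (single j i h.symm 1 : 𝔤)⁆ = singleSubSingle i j 1 := by
  refine Subtype.ext ?_
  rw [val_lie, val_single, val_single, val_singleSubSingle]
  simp

lemma single_lie_single {i j k : Fin 3} (h : i ≠ j) (h' : j ≠ k) (h'' : i ≠ k) :
    ⁅(single i j h 1 : 𝔤), (single j k h' 1 : 𝔤)⁆ = single i k h'' 1 := by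
  refine Subtype.ext ?_
  rw [val_lie, val_single, val_single, val_single]
  simp [Matrix.single_mul_single_of_ne, h''.symm]

lemma single_lie_single_of_ne {i j k l : Fin 3} (h : i ≠ j) (h' : k ≠ l) (hjk : j ≠ k)
    (hli : l ≠ i) : ⁅(single i j h 1 : 𝔤), (single k l h' 1 : 𝔤)⁆ = 0 := by
  refine Subtype.ext ?_
  rw [val_lie, val_single, val_single]
  simp [Matrix.single_mul_single_of_ne, hjk, hli]

lemma singleSubSingle_lie_single {i j k l : Fin 3} (h : k ≠ l) (c : ℂ)
    (hc : (if i = k then 1 else 0) - (if j = k then 1 else 0) - (if l = i then 1 else 0) +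
      (if l = j then 1 else 0) = c) :
    ⁅(singleSubSingle i j 1 : 𝔤), (single k l h 1 : 𝔤)⁆ = c • single k l h 1 := by
  refine Subtype.ext ?_
  have hl : ∀ i : Fin 3, Matrix.single i i (1 : ℂ) * Matrix.single k l 1 =
      (if i = k then 1 else 0 : ℂ) • Matrix.single k l 1 := fun i => by
    split_ifs with hi
    · simp [hi]
    · simp [Matrix.single_mul_single_of_ne, hi]
  have hr : ∀ i : Fin 3, Matrix.single k l (1 : ℂ) * Matrix.single i i 1 =
      (if l = i then 1 else 0 : ℂ) • Matrix.single k l 1 := fun i => by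
    split_ifs with hi
    · simp [hi]
    · simp [Matrix.single_mul_single_of_ne, hi]
  rw [val_lie, val_singleSubSingle, ← hc]
  change _ = _ • Matrix.single k l (1 : ℂ)
  rw [val_single, sub_mul, mul_sub, hl, hl, hr, hr]
  module

section Modules

variable (V : Type*) [AddCommGroup V] [Module ℂ V] [LieRingModule 𝔤 V] [LieModule ℂ 𝔤 V]

variable {V} in
omit [Module ℂ V] [LieModule ℂ 𝔤 V] in
lemma lie_lie_eq {X Y Z : 𝔤} (h : ⁅X, Y⁆ = Z) (v : V) : ⁅X, ⁅Y, v⁆⁆ = ⁅Y, ⁅X, v⁆⁆ + ⁅Z, v⁆ := by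
  rw [leibniz_lie, h, add_comm]

variable {V} in
omit [Module ℂ V] [LieModule ℂ 𝔤 V] in
lemma lie_single_comm {i j k l : Fin 3} (h : i ≠ j) (h' : k ≠ l) (hjk : j ≠ k) (hli : l ≠ i)
    (v : V) : ⁅(single i j h 1 : 𝔤), ⁅(single k l h' 1 : 𝔤), v⁆⁆ =
      ⁅(single k l h' 1 : 𝔤), ⁅(single i j h 1 : 𝔤), v⁆⁆ := by
  rw [lie_lie_eq (single_lie_single_of_ne h h' hjk hli), zero_lie, add_zero]

variable {V} in
lemma lie_diag_lie_single (i j k l : Fin 3) (h : k ≠ l) (c : ℂ)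
    (hc : (if i = k then 1 else 0) - (if j = k then 1 else 0) - (if l = i then 1 else 0) +
      (if l = j then 1 else 0) = c) (v : V) :
    ⁅(singleSubSingle i j 1 : 𝔤), ⁅(single k l h 1 : 𝔤), v⁆⁆ =
      ⁅(single k l h 1 : 𝔤), ⁅(singleSubSingle i j 1 : 𝔤), v⁆⁆ +
        c • ⁅(single k l h 1 : 𝔤), v⁆ := by
  rw [lie_lie_eq (singleSubSingle_lie_single h c hc), smul_lie]

/-- The action of the Chevalley generators of `𝔤` on a representation. -/
def chevalleyOps : ChevalleyOps V where
  E₁ := LieModule.toEnd ℂ 𝔤 V (single 0 1 (by decide) 1)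
  E₂ := LieModule.toEnd ℂ 𝔤 V (single 1 2 (by decide) 1)
  F₁ := LieModule.toEnd ℂ 𝔤 V (single 1 0 (by decide) 1)
  F₂ := LieModule.toEnd ℂ 𝔤 V (single 2 1 (by decide) 1)
  F₃ := LieModule.toEnd ℂ 𝔤 V (single 2 0 (by decide) 1)
  H₁ := LieModule.toEnd ℂ 𝔤 V (singleSubSingle 0 1 1)
  H₂ := LieModule.toEnd ℂ 𝔤 V (singleSubSingle 1 2 1)
  E₁F₁ := lie_lie_eq (single_lie_single_swap _)
  E₂F₂ := lie_lie_eq (single_lie_single_swap _)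
  E₁F₂ := lie_single_comm _ _ (by decide) (by decide)
  E₂F₁ := lie_single_comm _ _ (by decide) (by decide)
  E₁F₃ x := by
    have := lie_lie_eq (single_lie_single (i := 2) (j := 0) (k := 1) (by decide) (by decide)
      (by decide)) x
    exact eq_sub_of_add_eq this.symm
  E₂F₃ := lie_lie_eq (single_lie_single _ _ _)
  F₂F₁ := lie_lie_eq (single_lie_single _ _ _)
  F₁F₃ := lie_single_comm _ _ (by decide) (by decide)
  F₂F₃ := lie_single_comm _ _ (by decide) (by decide)
  H₁E₁ := lie_diag_lie_single _ _ _ _ _ _ (by norm_num [Fin.ext_iff])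
  H₁E₂ := lie_diag_lie_single _ _ _ _ _ _ (by norm_num [Fin.ext_iff])
  H₂E₁ := lie_diag_lie_single _ _ _ _ _ _ (by norm_num [Fin.ext_iff])
  H₂E₂ := lie_diag_lie_single _ _ _ _ _ _ (by norm_num [Fin.ext_iff])
  H₁F₁ := lie_diag_lie_single _ _ _ _ _ _ (by norm_num [Fin.ext_iff])
  H₁F₂ := lie_diag_lie_single _ _ _ _ _ _ (by norm_num [Fin.ext_iff])
  H₁F₃ := lie_diag_lie_single _ _ _ _ _ _ (by norm_num [Fin.ext_iff])
  H₂F₁ := lie_diag_lie_single _ _ _ _ _ _ (by norm_num [Fin.ext_iff])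
  H₂F₂ := lie_diag_lie_single _ _ _ _ _ _ (by norm_num [Fin.ext_iff])
  H₂F₃ := lie_diag_lie_single _ _ _ _ _ _ (by norm_num [Fin.ext_iff])

/-- The coroot of `α₁`, as an element of the Cartan subalgebra. -/
def coroot₁ : 𝔥 := ⟨singleSubSingle 0 1 1, fun i j hij => by
  simp [Matrix.sub_apply, Matrix.single_apply]; grind⟩

/-- The coroot of `α₂`, as an element of the Cartan subalgebra. -/
def coroot₂ : 𝔥 := ⟨singleSubSingle 1 2 1, fun i j hij => by
  simp [Matrix.sub_apply, Matrix.single_apply]; grind⟩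

lemma α₁_coroot₁ : α₁ coroot₁ = 2 := by
  change (Matrix.single 0 0 (1 : ℂ) - Matrix.single 1 1 1 : Matrix (Fin 3) (Fin 3) ℂ) 0 0 -
    (Matrix.single 0 0 (1 : ℂ) - Matrix.single 1 1 1 : Matrix (Fin 3) (Fin 3) ℂ) 1 1 = 2
  norm_num [Matrix.single_apply, Fin.ext_iff]

lemma α₁_coroot₂ : α₁ coroot₂ = -1 := by
  change (Matrix.single 1 1 (1 : ℂ) - Matrix.single 2 2 1 : Matrix (Fin 3) (Fin 3) ℂ) 0 0 -
    (Matrix.single 1 1 (1 : ℂ) - Matrix.single 2 2 1 : Matrix (Fin 3) (Fin 3) ℂ) 1 1 = -1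
  norm_num [Matrix.single_apply, Fin.ext_iff]

lemma α₂_coroot₁ : α₂ coroot₁ = -1 := by
  change (Matrix.single 0 0 (1 : ℂ) - Matrix.single 1 1 1 : Matrix (Fin 3) (Fin 3) ℂ) 1 1 -
    (Matrix.single 0 0 (1 : ℂ) - Matrix.single 1 1 1 : Matrix (Fin 3) (Fin 3) ℂ) 2 2 = -1
  norm_num [Matrix.single_apply, Fin.ext_iff]

lemma α₂_coroot₂ : α₂ coroot₂ = 2 := by
  change (Matrix.single 1 1 (1 : ℂ) - Matrix.single 2 2 1 : Matrix (Fin 3) (Fin 3) ℂ) 1 1 -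
    (Matrix.single 1 1 (1 : ℂ) - Matrix.single 2 2 1 : Matrix (Fin 3) (Fin 3) ℂ) 2 2 = 2
  norm_num [Matrix.single_apply, Fin.ext_iff]

lemma wt_coroot₁ (x y : ℤ) : wt x y coroot₁ = x := by
  simp only [wt, ω₁, ω₂, LinearMap.add_apply, LinearMap.smul_apply, α₁_coroot₁, α₂_coroot₁,
    zsmul_eq_mul, smul_eq_mul]
  ring

lemma wt_coroot₂ (x y : ℤ) : wt x y coroot₂ = y := by
  simp only [wt, ω₁, ω₂, LinearMap.add_apply, LinearMap.smul_apply, α₁_coroot₂, α₂_coroot₂,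
    zsmul_eq_mul, smul_eq_mul]
  ring

lemma trace_eq_zero (X : 𝔤) : X.val 0 0 + X.val 1 1 + X.val 2 2 = 0 := by
  have h : X.val.trace = 0 := X.property
  rwa [Matrix.trace_fin_three] at h

/-- A traceless diagonal matrix is a combination of the two simple coroots. -/
lemma eq_smul_coroot_sub (H : 𝔥) :
    H = H.val.val 0 0 • coroot₁ - H.val.val 2 2 • coroot₂ := by
  refine Subtype.ext (Subtype.ext (Matrix.ext fun i j => ?_))
  have ht := trace_eq_zero H.val
  have hd : ∀ i j, i ≠ j → H.val.val i j = 0 := fun i j h => H.property h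
  change _ = H.val.val 0 0 * (Matrix.single 0 0 1 - Matrix.single 1 1 1 :
      Matrix (Fin 3) (Fin 3) ℂ) i j - H.val.val 2 2 * (Matrix.single 1 1 1 - Matrix.single 2 2 1 :
      Matrix (Fin 3) (Fin 3) ℂ) i j
  rcases eq_or_ne i j with rfl | hij
  · fin_cases i <;> simp
    linear_combination ht
  · rw [hd i j hij]
    fin_cases i <;> fin_cases j <;> first | exact absurd rfl hij | simp

lemma eq_sum_single (X : 𝔤) :
    X = X.val 0 1 • single 0 1 (by decide) 1 + X.val 1 2 • single 1 2 (by decide) 1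
      + X.val 0 2 • single 0 2 (by decide) 1 + X.val 1 0 • single 1 0 (by decide) 1
      + X.val 2 1 • single 2 1 (by decide) 1 + X.val 2 0 • single 2 0 (by decide) 1
      + X.val 0 0 • singleSubSingle 0 1 1 + (-X.val 2 2) • singleSubSingle 1 2 1 := by
  have ht := trace_eq_zero X
  refine Subtype.ext (Matrix.ext fun i j => ?_)
  change _ = (X.val 0 1 • Matrix.single 0 1 1 + X.val 1 2 • Matrix.single 1 2 1 +
    X.val 0 2 • Matrix.single 0 2 1 + X.val 1 0 • Matrix.single 1 0 1 +
    X.val 2 1 • Matrix.single 2 1 1 + X.val 2 0 • Matrix.single 2 0 1 +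
    X.val 0 0 • (Matrix.single 0 0 1 - Matrix.single 1 1 1) +
    (-X.val 2 2) • (Matrix.single 1 1 1 - Matrix.single 2 2 1) : Matrix (Fin 3) (Fin 3) ℂ) i j
  generalize X.val = A at ht ⊢
  fin_cases i <;> fin_cases j <;> simp
  linear_combination ht

lemma mem_weightSpace_iff (x y : ℤ) (v : V) : v ∈ LieModule.weightSpace V (wt x y) ↔
    v ∈ (chevalleyOps V).weightSpace x y := by
  rw [LieModule.mem_weightSpace, ChevalleyOps.mem_weightSpace]
  constructor
  · intro h
    have h₁ := h coroot₁
    have h₂ := h coroot₂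
    rw [wt_coroot₁] at h₁
    rw [wt_coroot₂] at h₂
    exact ⟨h₁, h₂⟩
  · rintro ⟨h₁, h₂⟩ H
    have h₁' : ⁅coroot₁, v⁆ = (x : ℂ) • v := h₁
    have h₂' : ⁅coroot₂, v⁆ = (y : ℂ) • v := h₂
    rw [eq_smul_coroot_sub H, sub_lie, smul_lie, smul_lie, h₁', h₂', map_sub, map_smul, map_smul,
      wt_coroot₁, wt_coroot₂, smul_eq_mul, smul_eq_mul]
    module

lemma multiplicity_eq_finrank (x y : ℤ) :
    multiplicity V (wt x y) = finrank ℂ ((chevalleyOps V).weightSpace x y) := by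
  have h : (LieModule.weightSpace V (wt x y)).toSubmodule = (chevalleyOps V).weightSpace x y :=
    Submodule.ext (mem_weightSpace_iff V x y)
  rw [multiplicity, ← h]
  rfl

variable {V} in
/-- In an irreducible module a subspace stable under the Chevalley generators is a submodule, as
these generate `𝔤`. -/
lemma exists_isHighest [LieModule.IsIrreducible ℂ 𝔤 V] {a b : ℕ}
    (h : HasHighestWeight V (wt a b)) : ∃ v, (chevalleyOps V).IsHighest v a b := by
  obtain ⟨v, hv0, hv, hN⟩ := h
  rw [mem_weightSpace_iff, ChevalleyOps.mem_weightSpace] at hv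
  refine ⟨v, hv0, hN _ ?_, hN _ ?_, by simpa using hv.1, by simpa using hv.2,
    fun S hvS h₁ h₂ h₃ h₄ => ?_⟩
  · intro i j hij
    rw [val_single, Matrix.single_apply, if_neg (by omega)]
  · intro i j hij
    rw [val_single, Matrix.single_apply, if_neg (by omega)]
  have hlie : ∀ (X Y : 𝔤), (∀ u ∈ S, ⁅X, u⁆ ∈ S) → (∀ u ∈ S, ⁅Y, u⁆ ∈ S) →
      ∀ u ∈ S, ⁅⁅X, Y⁆, u⁆ ∈ S := fun X Y hX hY u hu => by
    rw [lie_lie]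
    exact S.sub_mem (hX _ (hY _ hu)) (hY _ (hX _ hu))
  have h₁' : ∀ u ∈ S, ⁅(single 0 1 (by decide) 1 : 𝔤), u⁆ ∈ S := h₁
  have h₂' : ∀ u ∈ S, ⁅(single 1 2 (by decide) 1 : 𝔤), u⁆ ∈ S := h₂
  have h₃' : ∀ u ∈ S, ⁅(single 1 0 (by decide) 1 : 𝔤), u⁆ ∈ S := h₃
  have h₄' : ∀ u ∈ S, ⁅(single 2 1 (by decide) 1 : 𝔤), u⁆ ∈ S := h₄
  have h₅ := hlie _ _ h₁' h₂'
  have h₆ := hlie _ _ h₄' h₃'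
  have h₇ := hlie _ _ h₁' h₃'
  have h₈ := hlie _ _ h₂' h₄'
  rw [single_lie_single _ _ (by decide)] at h₅ h₆
  rw [single_lie_single_swap] at h₇ h₈
  have hmem : ∀ (X : 𝔤), ∀ u ∈ S, ⁅X, u⁆ ∈ S := fun X u hu => by
    rw [eq_sum_single X]
    simp only [add_lie, smul_lie]
    exact add_mem (add_mem (add_mem (add_mem (add_mem (add_mem (add_mem
      (S.smul_mem _ (h₁' u hu)) (S.smul_mem _ (h₂' u hu))) (S.smul_mem _ (h₅ u hu)))
      (S.smul_mem _ (h₃' u hu))) (S.smul_mem _ (h₄' u hu))) (S.smul_mem _ (h₆ u hu)))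
      (S.smul_mem _ (h₇ u hu))) (S.smul_mem _ (h₈ u hu))
  let N : LieSubmodule ℂ 𝔤 V := { S with lie_mem := fun {X u} hu => hmem X u hu }
  have hvN : v ∈ N := hvS
  have htop : N = ⊤ := (eq_bot_or_eq_top N).resolve_left fun h0 =>
    hv0 ((LieSubmodule.mem_bot v).1 (h0 ▸ hvN))
  exact congrArg LieSubmodule.toSubmodule htop

end Modules

lemma exists_of_sub_mem_rootLattice {a b x y : ℤ} (h : wt a b - wt x y ∈ rootLattice) :
    ∃ m n : ℤ, x = a - 2 * m + n ∧ y = b + m - 2 * n := by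
  obtain ⟨m, n, hmn⟩ := AddSubgroup.mem_closure_pair.1 h
  refine ⟨m, n, ?_, ?_⟩
  · have := congrArg (fun φ => φ coroot₁) hmn
    simp only [LinearMap.add_apply, LinearMap.sub_apply, LinearMap.smul_apply, α₁_coroot₁,
      α₂_coroot₁, wt_coroot₁, zsmul_eq_mul] at this
    have h' : m * 2 + n * -1 = a - x := by exact_mod_cast this
    omega
  · have := congrArg (fun φ => φ coroot₂) hmn
    simp only [LinearMap.add_apply, LinearMap.sub_apply, LinearMap.smul_apply, α₁_coroot₂,
      α₂_coroot₂, wt_coroot₂, zsmul_eq_mul] at this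
    have h' : m * -1 + n * 2 = b - y := by exact_mod_cast this
    omega

/-- The multiplicity formula, with `λ - μ = m α₁ + n α₂`. -/
theorem multiplicity_eq (a b : ℕ) (V : Type*) [AddCommGroup V] [Module ℂ V] [LieRingModule 𝔤 V]
    [LieModule ℂ 𝔤 V] [FiniteDimensional ℂ V] [LieModule.IsIrreducible ℂ 𝔤 V]
    (h : HasHighestWeight V (wt a b)) (m n : ℤ) :
    (multiplicity V (wt (a - 2 * m + n) (b + m - 2 * n)) : ℤ) =
      max 0 (min (min (a : ℤ) n) (min m (a + n - m)) + 1 - max 0 (n - b)) := by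
  obtain ⟨v, hv⟩ := exists_isHighest h
  rw [multiplicity_eq_finrank, hv.finrank_weightSpace]

/-! ### The piecewise linear function -/

/-- The multiplicity function as a function of real arguments. It is written in terms of the real
numbers `m = (2(a - x) + (b - y)) / 3` and `n = ((a - x) + 2(b - y)) / 3` for which
`(a, b) - (x, y) = m α₁ + n α₂`. -/
noncomputable def multFun (p : ℝ × ℝ × ℝ × ℝ) : ℝ :=
  max 0 (min (min p.2.2.1 (((p.2.2.1 - p.1) + 2 * (p.2.2.2 - p.2.1)) / 3))
      (min ((2 * (p.2.2.1 - p.1) + (p.2.2.2 - p.2.1)) / 3)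
        (p.2.2.1 + ((p.2.2.1 - p.1) + 2 * (p.2.2.2 - p.2.1)) / 3 -
          (2 * (p.2.2.1 - p.1) + (p.2.2.2 - p.2.1)) / 3)) + 1 -
    max 0 (((p.2.2.1 - p.1) + 2 * (p.2.2.2 - p.2.1)) / 3 - p.2.2.2))

lemma continuous_multFun : Continuous multFun := by
  unfold multFun
  fun_prop

lemma multFun_intCast (a b m n : ℤ) :
    multFun ((a - 2 * m + n : ℤ), (b + m - 2 * n : ℤ), a, b) =
      (max 0 (min (min a n) (min m (a + n - m)) + 1 - max 0 (n - b)) : ℤ) := by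
  have h1 : (((a : ℝ) - (a - 2 * m + n : ℤ)) + 2 * (b - (b + m - 2 * n : ℤ))) / 3 = n := by
    push_cast
    ring
  have h2 : (2 * ((a : ℝ) - (a - 2 * m + n : ℤ)) + (b - (b + m - 2 * n : ℤ))) / 3 = m := by
    push_cast
    ring
  simp only [multFun, h1, h2]
  push_cast
  rfl

/-- The signs of three linear forms decide between rows, up to the choice between a row with zero
multiplicity and its neighbour. -/
lemma exists_rowIneq (x y a b : ℝ) : ∃ i, rowIneq x y a b i := by
  rcases le_total 0 (x - y - a + b) with h1 | h1 <;>
  rcases le_total 0 (x + 2 * y - a + b) with h2 | h2 <;>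
  rcases le_total 0 (-2 * x - y - a + b) with h3 | h3
  · exact ⟨13, by
      simp only [rowIneq, Matrix.cons_val]
      constructorm* _ ∧ _ <;> linarith⟩
  · rcases le_total 0 (2 * x + y - 2 * a - b - 3) with h4 | h4
    · exact ⟨0, by
      simp only [rowIneq, Matrix.cons_val]
      constructorm* _ ∧ _ <;> linarith⟩
    · exact ⟨6, by
      simp only [rowIneq, Matrix.cons_val]
      constructorm* _ ∧ _ <;> linarith⟩
  · rcases le_total 0 (-x - 2 * y - 2 * a - b - 3) with h4 | h4
    · exact ⟨4, by
      simp only [rowIneq, Matrix.cons_val]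
      constructorm* _ ∧ _ <;> linarith⟩
    · exact ⟨10, by
      simp only [rowIneq, Matrix.cons_val]
      constructorm* _ ∧ _ <;> linarith⟩
  · rcases le_total 0 (x - y - a - 2 * b - 3) with h4 | h4
    · exact ⟨5, by
      simp only [rowIneq, Matrix.cons_val]
      constructorm* _ ∧ _ <;> linarith⟩
    · exact ⟨11, by
      simp only [rowIneq, Matrix.cons_val]
      constructorm* _ ∧ _ <;> linarith⟩
  · rcases le_total 0 (-x + y - 2 * a - b - 3) with h4 | h4
    · exact ⟨2, by
      simp only [rowIneq, Matrix.cons_val]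
      constructorm* _ ∧ _ <;> linarith⟩
    · exact ⟨8, by
      simp only [rowIneq, Matrix.cons_val]
      constructorm* _ ∧ _ <;> linarith⟩
  · rcases le_total 0 (x + 2 * y - a - 2 * b - 3) with h4 | h4
    · exact ⟨1, by
      simp only [rowIneq, Matrix.cons_val]
      constructorm* _ ∧ _ <;> linarith⟩
    · exact ⟨7, by
      simp only [rowIneq, Matrix.cons_val]
      constructorm* _ ∧ _ <;> linarith⟩
  · rcases le_total 0 (-2 * x - y - a - 2 * b - 3) with h4 | h4
    · exact ⟨3, by
      simp only [rowIneq, Matrix.cons_val]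
      constructorm* _ ∧ _ <;> linarith⟩
    · exact ⟨9, by
      simp only [rowIneq, Matrix.cons_val]
      constructorm* _ ∧ _ <;> linarith⟩
  · exact ⟨12, by
      simp only [rowIneq, Matrix.cons_val]
      constructorm* _ ∧ _ <;> linarith⟩

lemma multFun_eq_rowValue (x y a b : ℝ) (ha : 0 ≤ a) (hb : 0 ≤ b) (i : Fin 14)
    (h : rowIneq x y a b i) : multFun (x, y, a, b) = rowValue x y a b i := by
  -- In the coordinates `m`, `n` all inequalities and expressions have integral coefficients.
  set n := ((a - x) + 2 * (b - y)) / 3 with hn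
  set m := (2 * (a - x) + (b - y)) / 3 with hm
  have hF : multFun (x, y, a, b) = max 0 (min (min a n) (min m (a + n - m)) + 1 - max 0 (n - b)) :=
    rfl
  have hx : x = a - 2 * m + n := by rw [hm, hn]; ring
  have hy : y = b + m - 2 * n := by rw [hm, hn]; ring
  rw [hF]
  clear hF
  clear_value m n
  subst hx hy
  obtain ⟨M, hM, hMa, hMn, hMm, hMs, hM'⟩ : ∃ M, min (min a n) (min m (a + n - m)) = M ∧ M ≤ a ∧
      M ≤ n ∧ M ≤ m ∧ M ≤ a + n - m ∧ ((M = a ∨ M = n) ∨ M = m ∨ M = a + n - m) :=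
    ⟨_, rfl, by simp, by simp, by simp, by simp,
      (min_choice _ _).imp (fun h => by rw [h]; exact min_choice _ _)
        (fun h => by rw [h]; exact min_choice _ _)⟩
  obtain ⟨Q, hQ, hQ0, hQn, hQ'⟩ : ∃ Q, max 0 (n - b) = Q ∧ 0 ≤ Q ∧ n - b ≤ Q ∧
      (Q = 0 ∨ Q = n - b) := ⟨_, rfl, by simp, by simp, max_choice _ _⟩
  rw [hM, hQ]
  clear hM hQ
  fin_cases i <;>
  simp only [rowIneq, rowValue, Matrix.cons_val, Fin.mk_one, Fin.zero_eta, Fin.reduceFinMk]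
    at h ⊢ <;>
  first
  | exact max_eq_left (by linarith)
  | rw [max_eq_right]
    all_goals
      rcases hM' with (rfl | rfl) | rfl | rfl <;> rcases hQ' with rfl | rfl <;> linarith

end SlThree

open SlThree in
/-- The 14 polyhedra cover `ℝ⁴`; on the region `a, b ≥ 0` the 14 expressions glue to a continuous
function; and this function computes the weight multiplicities of the irreducible module with
highest weight `(a, b)` at every weight `(x, y)` congruent to `(a, b)` modulo the root lattice. -/
theorem mainTheorem3 :
    (∀ x y a b : ℝ, ∃ i, rowIneq x y a b i) ∧
    ∃ F : ℝ × ℝ × ℝ × ℝ → ℝ,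
      ContinuousOn F {p | 0 ≤ p.2.2.1 ∧ 0 ≤ p.2.2.2} ∧
      (∀ x y a b : ℝ, 0 ≤ a → 0 ≤ b → ∀ i, rowIneq x y a b i → F (x, y, a, b) = rowValue x y a b i) ∧
      ∀ (a b : ℤ), 0 ≤ a → 0 ≤ b →
        ∀ (V : Type*) [AddCommGroup V] [Module ℂ V] [LieRingModule 𝔤 V] [LieModule ℂ 𝔤 V]
          [FiniteDimensional ℂ V] [LieModule.IsIrreducible ℂ 𝔤 V],
          HasHighestWeight V (wt a b) →
          ∀ x y : ℤ, wt a b - wt x y ∈ rootLattice →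
            (multiplicity V (wt x y) : ℝ) = F (x, y, a, b) := by
  refine ⟨exists_rowIneq, multFun, continuous_multFun.continuousOn, multFun_eq_rowValue, ?_⟩
  intro a b ha hb V _ _ _ _ _ _ hV x y hxy
  lift a to ℕ using ha
  lift b to ℕ using hb
  obtain ⟨m, n, rfl, rfl⟩ := exists_of_sub_mem_rootLattice hxy
  rw [multFun_intCast, ← multiplicity_eq a b V hV m n, Int.cast_natCast]
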